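/- Let $(\Omega,\mu)$ be a probability space and let $\Gamma:\Omega^2\to[0,1]$ be a digraphon, i.e. a measurable function. All sets below are measurable subsets of $\Omega$. A set $S$ of positive measure is *strongly connected* if $\int_{A\times B}\Gamma>0$ for every partition $S=A\sqcup B$ with $\mu(A),\mu(B)>0$. It is a *strong component* if it is strongly connected and no set $Y$ with $\mu(S\cap Y)>0$ and $\mu(Y\setminus S)>0$ is strongly connected. It is *fragmented* if no subset $Y\subseteq S$ of positive measure is strongly connected. Let $\Omega=X_0\sqcup\bigsqcup_{i\in I}X_i$ be a decomposition with $I$ finite or countable, where each $X_i$ ($i\in I$) is a strong component and $X_0$ is fragmented or empty. For $k\ge1$ let $\Gamma^k(x_0,x_k)=\int\prod_{j=1}^{k}\Gamma(x_{j-1},x_j)\,\mathrm d\mu^{k-1}(x_1,\dots,x_{k-1})$, and let $\mathrm{ReachOut}_\Gamma(x)=\{y\in\Omega:\Gamma^k(x,y)>0\text{ for some }k\ge1\}$ be the set of points reachable from $x$. Let $X\subseteq X_0$ have positive measure. Define $g:X\to[0,\mu(X)]$ by $g(x)=\mu(\mathrm{ReachOut}_\Gamma(x)\cap X)$, and for real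 $a\ge0$ put $F_a=\{x\in X: a\le g(x)\le1\}$. Then: 1. For every $a\ge0$ and almost every $x\in F_a$ we have $\mu\big((\mathrm{ReachOut}_\Gamma(x)\cap X)\setminus F_a\big)\ge a$. 2. For every $a\in[0,\mu(X)]$ we have $\mu(F_a)\le\mu(X)-a$. 3. $\Gamma(x,y)=0$ for $\mu^2$-almost every $(x,y)\in X^2$ with $g(x)\le g(y)$. 4. $\rho(\Gamma\llbracket X\rrbracket)=0$, where $\Gamma\llbracket X\rrbracket$ equals $\Gamma$ on $X\times X$ and $0$ elsewhere, and $\rho$ of a digraphon $U$ is the spectral radius of the bounded operator $(T_Uf)(x)=\int_\Omega f(y)\,U(y,x)\,\mathrm d\mu(y)$ on the complex space $L^2(\Omega)$. -/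

import Mathlib

open MeasureTheory

noncomputable section

/-- A digraphon on `Ω`: a jointly measurable function `Ω × Ω → [0, 1]`. -/
structure Digraphon (Ω : Type*) [MeasurableSpace Ω] where
  toFun : Ω → Ω → ℝ
  measurable' : Measurable (fun p : Ω × Ω => toFun p.1 p.2)
  nonneg' : ∀ x y, 0 ≤ toFun x y
  le_one' : ∀ x y, toFun x y ≤ 1

namespace Digraphon

variable {Ω : Type*} [MeasurableSpace Ω]

instance : CoeFun (Digraphon Ω) (fun _ => Ω → Ω → ℝ) := ⟨Digraphon.toFun⟩

open Classical in
/-- The digraphon `Γ⟦A⟧` on `Ω`: equal to `Γ` on `A × A` and to `0` elsewhere. -/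
def restrict (Γ : Digraphon Ω) (A : Set Ω) (hA : MeasurableSet A) : Digraphon Ω where
  toFun x y := if x ∈ A ∧ y ∈ A then Γ x y else 0
  measurable' := Measurable.ite (hA.prod hA) Γ.measurable' measurable_const
  nonneg' x y := by
    split_ifs
    · exact Γ.nonneg' x y
    · exact le_rfl
  le_one' x y := by
    split_ifs
    · exact Γ.le_one' x y
    · exact zero_le_one

variable (μ : Measure Ω)

theorem norm_kernel_le (Γ : Digraphon Ω) (f : Lp ℂ 2 μ) (x y : Ω) :
    ‖f y * (Γ y x : ℂ)‖ ≤ ‖f y‖ := by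
  rw [norm_mul, Complex.norm_real, Real.norm_of_nonneg (Γ.nonneg' y x)]
  exact mul_le_of_le_one_right (norm_nonneg _) (Γ.le_one' y x)

variable [IsProbabilityMeasure μ]

/-- The kernel product `(x, y) ↦ ∫ Γ(x, z) Δ(z, y) dμ(z)`. -/
def comp (Γ Δ : Digraphon Ω) : Digraphon Ω where
  toFun x y := ∫ z, Γ x z * Δ z y ∂μ
  measurable' := by
    have h : Measurable (fun q : (Ω × Ω) × Ω => Γ q.1.1 q.2 * Δ q.2 q.1.2) :=
      (Γ.measurable'.comp ((measurable_fst.comp measurable_fst).prodMk measurable_snd)).mul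
        (Δ.measurable'.comp (measurable_snd.prodMk (measurable_snd.comp measurable_fst)))
    exact h.stronglyMeasurable.integral_prod_right'.measurable
  nonneg' x y := integral_nonneg fun z => mul_nonneg (Γ.nonneg' x z) (Δ.nonneg' z y)
  le_one' x y := by
    have h : ∀ z, ‖Γ x z * Δ z y‖ ≤ 1 := fun z => by
      rw [Real.norm_of_nonneg (mul_nonneg (Γ.nonneg' x z) (Δ.nonneg' z y))]
      exact mul_le_one₀ (Γ.le_one' x z) (Δ.nonneg' z y) (Δ.le_one' z y)
    have := norm_integral_le_of_norm_le_const (μ := μ) (Filter.Eventually.of_forall h)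
    simpa using (le_abs_self _).trans this

/-- `Γ.pathDensity μ n` is the power `Γ^(n+1)` of the digraphon, that is,
`(x, y) ↦ ∫ Γ(x, z₁) Γ(z₁, z₂) ⋯ Γ(zₙ, y) dμⁿ(z)`, the density of the directed paths from `x`
to `y` with `n` internal vertices; the integral is written as an iterated one. -/
def pathDensity (Γ : Digraphon Ω) : ℕ → Digraphon Ω
  | 0 => Γ
  | n + 1 => comp μ Γ (pathDensity Γ n)

/-- The set of the points `y` that are reachable from `x`: `Γ^k(x, y) > 0` for some `k ≥ 1`. -/
def ReachOut (Γ : Digraphon Ω) (x : Ω) : Set Ω :=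
  {y | ∃ n : ℕ, 0 < Γ.pathDensity μ n x y}

/-- `S` is strongly connected in `Γ`. -/
def StronglyConnected (Γ : Digraphon Ω) (S : Set Ω) : Prop :=
  MeasurableSet S ∧ 0 < μ S ∧
    ∀ A B : Set Ω, MeasurableSet A → MeasurableSet B → Disjoint A B → A ∪ B = S →
      0 < μ A → 0 < μ B → 0 < ∫ p in A ×ˢ B, Γ p.1 p.2 ∂(μ.prod μ)

/-- `S` is a strong component in `Γ`. -/
def IsStrongComponent (Γ : Digraphon Ω) (S : Set Ω) : Prop :=
  Γ.StronglyConnected μ S ∧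
    ∀ Y : Set Ω, MeasurableSet Y → 0 < μ (S ∩ Y) → 0 < μ (Y \ S) → ¬ Γ.StronglyConnected μ Y

/-- `S` is fragmented in `Γ`. -/
def Fragmented (Γ : Digraphon Ω) (S : Set Ω) : Prop :=
  MeasurableSet S ∧ 0 < μ S ∧
    ∀ Y : Set Ω, MeasurableSet Y → Y ⊆ S → 0 < μ Y → ¬ Γ.StronglyConnected μ Y

/-- `Ω = X₀ ⊔ ⨆ᵢ Cᵢ` is a decomposition of `Γ` into strong components `Cᵢ` and a fragmented
(or empty) set `X₀`. -/
structure IsStrongDecomposition {ι : Type*} (Γ : Digraphon Ω) (X₀ : Set Ω) (C : ι → Set Ω) :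
    Prop where
  union_eq : X₀ ∪ ⋃ i, C i = Set.univ
  disjoint_fragmented : ∀ i, Disjoint X₀ (C i)
  pairwise_disjoint : Pairwise fun i j => Disjoint (C i) (C j)
  fragmented : X₀ = ∅ ∨ Γ.Fragmented μ X₀
  component : ∀ i, Γ.IsStrongComponent μ (C i)

/-- `Γ.reachMeasure μ X x` is the measure of the part of `X` that is reachable from `x`. -/
def reachMeasure (Γ : Digraphon Ω) (X : Set Ω) (x : Ω) : ℝ :=
  μ.real (Γ.ReachOut μ x ∩ X)

/-- The set of the points `x` of `X` with `a ≤ g(x) ≤ 1`, where `g(x)` is the measure of the part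
of `X` that is reachable from `x`. -/
def superlevel (Γ : Digraphon Ω) (X : Set Ω) (a : ℝ) : Set Ω :=
  {x ∈ X | Γ.reachMeasure μ X x ∈ Set.Icc a 1}

theorem integrable_Lp (f : Lp ℂ 2 μ) : Integrable f μ :=
  (Lp.memLp f).integrable one_le_two

theorem integrable_kernel (Γ : Digraphon Ω) (f : Lp ℂ 2 μ) (x : Ω) :
    Integrable (fun y => f y * (Γ y x : ℂ)) μ := by
  refine (integrable_Lp μ f).mono ?_ (Filter.Eventually.of_forall (norm_kernel_le μ Γ f x))
  have h : Measurable fun y => Γ y x := Γ.measurable'.comp (measurable_id.prodMk measurable_const)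
  exact (Lp.aestronglyMeasurable f).mul
    (Complex.measurable_ofReal.comp h).aestronglyMeasurable

theorem norm_integral_kernel_le (Γ : Digraphon Ω) (f : Lp ℂ 2 μ) (x : Ω) :
    ‖∫ y, f y * (Γ y x : ℂ) ∂μ‖ ≤ ‖f‖ := by
  have h1 : ‖∫ y, f y * (Γ y x : ℂ) ∂μ‖ ≤ ∫ y, ‖f y‖ ∂μ :=
    norm_integral_le_of_norm_le (integrable_Lp μ f).norm
      (Filter.Eventually.of_forall (norm_kernel_le μ Γ f x))
  have h2 : ∫ y, ‖f y‖ ∂μ = (eLpNorm f 1 μ).toReal := by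
    rw [integral_norm_eq_lintegral_enorm (Lp.aestronglyMeasurable f),
      eLpNorm_one_eq_lintegral_enorm]
  rw [h2] at h1
  refine h1.trans ?_
  rw [Lp.norm_def]
  exact ENNReal.toReal_mono (Lp.eLpNorm_ne_top f)
    (eLpNorm_le_eLpNorm_of_exponent_le one_le_two (Lp.aestronglyMeasurable f))

theorem memLp_integral_kernel (Γ : Digraphon Ω) (f : Lp ℂ 2 μ) :
    MemLp (fun x => ∫ y, f y * (Γ y x : ℂ) ∂μ) 2 μ := by
  refine MemLp.of_bound ?_ ‖f‖ (Filter.Eventually.of_forall (norm_integral_kernel_le μ Γ f))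
  have h : StronglyMeasurable fun p : Ω × Ω => f p.2 * (Γ p.2 p.1 : ℂ) :=
    ((Lp.stronglyMeasurable f).comp_measurable measurable_snd).mul
      (Complex.measurable_ofReal.comp
        (Γ.measurable'.comp measurable_swap)).stronglyMeasurable
  exact h.integral_prod_right'.aestronglyMeasurable

/-- The integral kernel operator `(T_Γ f)(x) = ∫ f(y) Γ(y, x) dμ(y)` on the complex `L²(Ω)`. -/
def operator (Γ : Digraphon Ω) : Lp ℂ 2 μ →L[ℂ] Lp ℂ 2 μ :=
  LinearMap.mkContinuous
    { toFun := fun f => (memLp_integral_kernel μ Γ f).toLp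
      map_add' := fun f g => by
        rw [← MemLp.toLp_add, MemLp.toLp_eq_toLp_iff]
        refine Filter.Eventually.of_forall fun x => ?_
        rw [Pi.add_apply, ← integral_add (integrable_kernel μ Γ f x) (integrable_kernel μ Γ g x)]
        refine integral_congr_ae ?_
        filter_upwards [Lp.coeFn_add f g] with y hy
        rw [hy, Pi.add_apply, add_mul]
      map_smul' := fun c f => by
        rw [RingHom.id_apply, ← MemLp.toLp_const_smul, MemLp.toLp_eq_toLp_iff]
        refine Filter.Eventually.of_forall fun x => ?_
        rw [Pi.smul_apply, ← integral_smul]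
        refine integral_congr_ae ?_
        filter_upwards [Lp.coeFn_smul c f] with y hy
        rw [hy, Pi.smul_apply, smul_mul_assoc] }
    1
    (fun f => by
      have h := Lp.norm_le_of_ae_bound (f := (memLp_integral_kernel μ Γ f).toLp) (norm_nonneg f)
        (by
          filter_upwards [(memLp_integral_kernel μ Γ f).coeFn_toLp] with x hx
          rw [hx]
          exact norm_integral_kernel_le μ Γ f x)
      have h1 : (measureUnivNNReal μ : ℝ) = 1 := by simp [measureUnivNNReal]
      rw [h1, Real.one_rpow] at h
      exact h)

/-- The spectral radius `ρ(Γ)`: that of the bounded operator `T_Γ` on the complex `L²(Ω)`. -/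
def rho (Γ : Digraphon Ω) : ENNReal :=
  spectralRadius ℂ (Γ.operator μ)

end Digraphon

end

/-! ### Reachability as a relation modulo null sets -/

noncomputable section

namespace Digraphon

variable {Ω : Type*} [MeasurableSpace Ω] (μ : Measure Ω) [IsProbabilityMeasure μ]

/-! Up to null sets, reachability is transitive, so the points mutually reachable with a typical `x`
form a null or a strongly connected set. A strongly connected set meets `X₀` in a null set; hence on
`X` reachability is antisymmetric almost everywhere (`ae_not_mutual`).

Antisymmetry yields halving: a set `Z` of points of `F` reachable from `x` contains a point that
reaches at most half of `Z`. Iterating inside a superlevel set `F` of `g` gives a point `y ∈ F` that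
reaches almost nothing of `F`, but at least `a` of `X`, all of it essentially reachable from `x`. So
`x` reaches measure at least `a` outside `F`, which is claim 1. Claim 2 follows by counting measure,
and claim 3 by taking `a = g x`.

By claim 3 the kernel is supported where `g` strictly decreases along arcs. Powers of the operator
are then dominated by the mass of `g`-monotone chains, which is at most `1 / n!`
(`factorial_mul_chainMass_le`), and the spectral radius vanishes. -/

theorem comp_eq_zero_iff (Γ Δ : Digraphon Ω) (x y : Ω) :
    comp μ Γ Δ x y = 0 ↔ ∀ᵐ z ∂μ, Γ x z = 0 ∨ Δ z y = 0 := by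
  have h0 : ∀ z, 0 ≤ Γ x z * Δ z y := fun z => mul_nonneg (Γ.nonneg' x z) (Δ.nonneg' z y)
  have hm : Measurable fun z => Γ x z * Δ z y :=
    (Γ.measurable'.comp (measurable_const.prodMk measurable_id)).mul
      (Δ.measurable'.comp (measurable_id.prodMk measurable_const))
  have hi : Integrable (fun z => Γ x z * Δ z y) μ := by
    refine Integrable.of_bound hm.aestronglyMeasurable 1 (Filter.Eventually.of_forall fun z => ?_)
    rw [Real.norm_of_nonneg (h0 z)]
    exact mul_le_one₀ (Γ.le_one' x z) (Δ.nonneg' z y) (Δ.le_one' z y)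
  have h := integral_eq_zero_iff_of_nonneg (μ := μ) h0 hi
  refine h.trans ⟨fun H => ?_, fun H => ?_⟩
  · filter_upwards [H] with z hz
    exact mul_eq_zero.mp hz
  · filter_upwards [H] with z hz
    exact mul_eq_zero.mpr hz

theorem measurableSet_eq_zero (Γ : Digraphon Ω) :
    MeasurableSet {p : Ω × Ω | Γ p.1 p.2 = 0} :=
  Γ.measurable' (measurableSet_singleton 0)

/-- Cut a path at an internal vertex `z`: since index `n` stands for the power `n + 1`, the two
pieces compose to index `n + m + 1`. The induction peels off the first arc, and Fubini exchanges its
endpoint with the cut vertex. -/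
theorem ae_pathDensity_eq_zero_or (Γ : Digraphon Ω) (n m : ℕ) (x y : Ω)
    (h : Γ.pathDensity μ (n + m + 1) x y = 0) :
    ∀ᵐ z ∂μ, Γ.pathDensity μ n x z = 0 ∨ Γ.pathDensity μ m z y = 0 := by
  induction n generalizing x with
  | zero => rw [zero_add] at h; exact (comp_eq_zero_iff μ _ _ x y).mp h
  | succ n ih =>
    have e : n + 1 + m + 1 = (n + m + 1) + 1 := by ring
    rw [e] at h
    have h1 := (comp_eq_zero_iff μ _ _ x y).mp h
    have h2 : ∀ᵐ w ∂μ, ∀ᵐ z ∂μ, Γ x w = 0 ∨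
        (Γ.pathDensity μ n w z = 0 ∨ Γ.pathDensity μ m z y = 0) := by
      filter_upwards [h1] with w hw
      rcases hw with hw | hw
      · exact Filter.Eventually.of_forall fun z => Or.inl hw
      · filter_upwards [ih w hw] with z hz using Or.inr hz
    rw [Measure.ae_ae_comm] at h2
    · filter_upwards [h2] with z hz
      by_cases hy : Γ.pathDensity μ m z y = 0
      · exact Or.inr hy
      · refine Or.inl ((comp_eq_zero_iff μ _ _ x z).mpr ?_)
        filter_upwards [hz] with w hw
        tauto
    · refine MeasurableSet.union ?_ (MeasurableSet.union ?_ ?_)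
      · exact (measurable_const.prodMk measurable_fst) Γ.measurableSet_eq_zero
      · exact (Γ.pathDensity μ n).measurableSet_eq_zero
      · exact (measurable_snd.prodMk measurable_const) (Γ.pathDensity μ m).measurableSet_eq_zero

theorem not_mem_reachOut_iff (Γ : Digraphon Ω) {x y : Ω} :
    y ∉ Γ.ReachOut μ x ↔ ∀ n, Γ.pathDensity μ n x y = 0 := by
  simp only [ReachOut, Set.mem_ofPred_eq, not_exists, not_lt]
  exact forall_congr' fun n => ⟨fun h => le_antisymm h (nonneg' _ _ _), fun h => h.le⟩

theorem eq_zero_of_not_mem_reachOut (Γ : Digraphon Ω) {x y : Ω} (h : y ∉ Γ.ReachOut μ x) :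
    Γ x y = 0 :=
  (not_mem_reachOut_iff μ Γ).mp h 0

theorem measurableSet_reach (Γ : Digraphon Ω) :
    MeasurableSet {p : Ω × Ω | p.2 ∈ Γ.ReachOut μ p.1} := by
  have : {p : Ω × Ω | p.2 ∈ Γ.ReachOut μ p.1}
      = ⋃ n : ℕ, {p : Ω × Ω | 0 < Γ.pathDensity μ n p.1 p.2} := by
    ext p; simp [ReachOut]
  rw [this]
  exact MeasurableSet.iUnion fun n =>
    measurableSet_lt measurable_const (Γ.pathDensity μ n).measurable'

theorem measurableSet_reachOut (Γ : Digraphon Ω) (x : Ω) : MeasurableSet (Γ.ReachOut μ x) :=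
  measurable_prodMk_left (measurableSet_reach μ Γ)

theorem measurableSet_reachIn (Γ : Digraphon Ω) (x : Ω) :
    MeasurableSet {y | x ∈ Γ.ReachOut μ y} :=
  measurable_prodMk_right (measurableSet_reach μ Γ)

/-- Reachability is transitive up to null sets. -/
theorem ae_not_mem_reachOut_or (Γ : Digraphon Ω) {x y : Ω} (h : y ∉ Γ.ReachOut μ x) :
    ∀ᵐ z ∂μ, z ∉ Γ.ReachOut μ x ∨ y ∉ Γ.ReachOut μ z := by
  rw [not_mem_reachOut_iff] at h
  have : ∀ n m, ∀ᵐ z ∂μ, Γ.pathDensity μ n x z = 0 ∨ Γ.pathDensity μ m z y = 0 :=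
    fun n m => ae_pathDensity_eq_zero_or μ Γ n m x y (h _)
  simp only [← ae_all_iff] at this
  filter_upwards [this] with z hz
  rw [not_mem_reachOut_iff, not_mem_reachOut_iff]
  by_contra! hc
  obtain ⟨⟨n, hn⟩, m, hm⟩ := hc
  exact (hz n m).elim hn hm

theorem ae_reachOut_subset (Γ : Digraphon Ω) (x : Ω) :
    ∀ᵐ y ∂μ, y ∈ Γ.ReachOut μ x → ∀ᵐ z ∂μ, z ∈ Γ.ReachOut μ y → z ∈ Γ.ReachOut μ x := by
  have h : ∀ᵐ z ∂μ, ∀ᵐ y ∂μ,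
      z ∈ Γ.ReachOut μ x ∨ (y ∉ Γ.ReachOut μ x ∨ z ∉ Γ.ReachOut μ y) := by
    refine Filter.Eventually.of_forall fun z => ?_
    by_cases hz : z ∈ Γ.ReachOut μ x
    · exact Filter.Eventually.of_forall fun y => Or.inl hz
    · filter_upwards [ae_not_mem_reachOut_or μ Γ hz] with y hy using Or.inr hy
  rw [Measure.ae_ae_comm] at h
  · filter_upwards [h] with y hy hxy
    filter_upwards [hy] with z hz hyz
    tauto
  · refine MeasurableSet.union (measurable_fst (measurableSet_reachOut μ Γ x))
      (MeasurableSet.union (measurable_snd (measurableSet_reachOut μ Γ x).compl)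
        (measurable_swap (measurableSet_reach μ Γ).compl))

/-- A set without outgoing arcs is not left by directed paths. -/
theorem ae_not_mem_reachOut_of_closed (Γ : Digraphon Ω) {T : Set Ω} (hT : MeasurableSet T)
    (h : ∀ᵐ y ∂μ, y ∈ T → ∀ᵐ z ∂μ, z ∉ T → Γ y z = 0) :
    ∀ᵐ y ∂μ, y ∈ T → ∀ᵐ z ∂μ, z ∉ T → z ∉ Γ.ReachOut μ y := by
  have key : ∀ n, ∀ᵐ y ∂μ, y ∈ T → ∀ᵐ z ∂μ, z ∉ T → Γ.pathDensity μ n y z = 0 := by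
    intro n
    induction n with
    | zero => exact h
    | succ n ih =>
      have h1 : ∀ᵐ w ∂μ, ∀ᵐ z ∂μ, w ∉ T ∨ (z ∈ T ∨ Γ.pathDensity μ n w z = 0) := by
        filter_upwards [ih] with w hw
        by_cases hwT : w ∈ T
        · filter_upwards [hw hwT] with z hz
          tauto
        · exact Filter.Eventually.of_forall fun z => Or.inl hwT
      rw [Measure.ae_ae_comm] at h1
      · filter_upwards [h] with y hy hyT
        filter_upwards [h1] with z hz hzT
        refine (comp_eq_zero_iff μ _ _ y z).mpr ?_
        filter_upwards [hy hyT, hz] with w hw1 hw2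
        tauto
      · exact (measurable_fst hT.compl).union
          ((measurable_snd hT).union (Γ.pathDensity μ n).measurableSet_eq_zero)
  rw [← ae_all_iff] at key
  filter_upwards [key] with y hy hyT
  have : ∀ n, ∀ᵐ z ∂μ, z ∉ T → Γ.pathDensity μ n y z = 0 := fun n => hy n hyT
  rw [← ae_all_iff] at this
  filter_upwards [this] with z hz hzT
  exact (not_mem_reachOut_iff μ Γ).mpr fun n => hz n hzT

/-! ### Mutual reachability, strong connectedness and the fragmented part -/

theorem integrable_prod (Γ : Digraphon Ω) :
    Integrable (fun p : Ω × Ω => Γ p.1 p.2) (μ.prod μ) :=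
  Integrable.of_bound Γ.measurable'.aestronglyMeasurable 1 (Filter.Eventually.of_forall fun p => by
    rw [Real.norm_of_nonneg (Γ.nonneg' _ _)]; exact Γ.le_one' _ _)

theorem ae_eq_zero_of_setIntegral_eq_zero (Γ : Digraphon Ω) {A B : Set Ω} (hA : MeasurableSet A)
    (hB : MeasurableSet B) (h : ∫ p in A ×ˢ B, Γ p.1 p.2 ∂(μ.prod μ) = 0) :
    ∀ᵐ y ∂μ, ∀ᵐ z ∂μ, y ∈ A → z ∈ B → Γ y z = 0 := by
  have h1 := (setIntegral_eq_zero_iff_of_nonneg_ae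
    (Filter.Eventually.of_forall fun p : Ω × Ω => Γ.nonneg' p.1 p.2)
    (integrable_prod μ Γ).integrableOn).mp h
  have h2 := (ae_restrict_iff' (hA.prod hB)).mp h1
  filter_upwards [Measure.ae_ae_of_ae_prod h2] with y hy
  filter_upwards [hy] with z hz hyA hzB
  exact hz ⟨hyA, hzB⟩

/-- Fubini applied to `ae_reachOut_subset`: the intermediate point is now the one fixed first. Most
of the work is the measurability that the exchange needs. -/
theorem ae_reachOut_subset_of_mem (Γ : Digraphon Ω) :
    ∀ᵐ x ∂μ, ∀ᵐ a ∂μ, x ∈ Γ.ReachOut μ a →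
      ∀ᵐ z ∂μ, z ∈ Γ.ReachOut μ x → z ∈ Γ.ReachOut μ a := by
  have hm : MeasurableSet {p : Ω × Ω | p.2 ∈ Γ.ReachOut μ p.1 →
      ∀ᵐ z ∂μ, z ∈ Γ.ReachOut μ p.2 → z ∈ Γ.ReachOut μ p.1} := by
    have hs : MeasurableSet {q : (Ω × Ω) × Ω |
        ¬ (q.2 ∈ Γ.ReachOut μ q.1.2 → q.2 ∈ Γ.ReachOut μ q.1.1)} := by
      have e : {q : (Ω × Ω) × Ω |
        ¬ (q.2 ∈ Γ.ReachOut μ q.1.2 → q.2 ∈ Γ.ReachOut μ q.1.1)} =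
        {q | q.2 ∈ Γ.ReachOut μ q.1.2} ∩ {q | q.2 ∈ Γ.ReachOut μ q.1.1}ᶜ := by
        ext q; simp
      rw [e]
      exact (((measurable_snd.comp measurable_fst).prodMk measurable_snd)
          (measurableSet_reach μ Γ)).inter
        (((measurable_fst.comp measurable_fst).prodMk measurable_snd)
          (measurableSet_reach μ Γ)).compl
    have h1 := measurable_measure_prodMk_left (ν := μ) hs
    have h2 := (measurableSet_reach μ Γ).compl.union (h1 (measurableSet_singleton 0))
    convert h2 using 1
    ext p
    rw [Set.mem_ofPred_eq, imp_iff_not_or]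
    rfl
  have h : ∀ᵐ a ∂μ, ∀ᵐ x ∂μ, x ∈ Γ.ReachOut μ a →
      ∀ᵐ z ∂μ, z ∈ Γ.ReachOut μ x → z ∈ Γ.ReachOut μ a :=
    Filter.Eventually.of_forall fun a => ae_reachOut_subset μ Γ a
  rw [Measure.ae_ae_comm] at h
  · exact h
  · exact hm

/-- The set of the points that are mutually reachable with a typical point `x` is null or
strongly connected. -/
theorem ae_stronglyConnected_mutual (Γ : Digraphon Ω) :
    ∀ᵐ x ∂μ, 0 < μ {y | y ∈ Γ.ReachOut μ x ∧ x ∈ Γ.ReachOut μ y} →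
      Γ.StronglyConnected μ {y | y ∈ Γ.ReachOut μ x ∧ x ∈ Γ.ReachOut μ y} := by
  filter_upwards [ae_reachOut_subset_of_mem μ Γ] with x hx hpos
  have hR := measurableSet_reachOut μ Γ x
  have hQ := measurableSet_reachIn μ Γ x
  refine ⟨hR.inter hQ, hpos, fun A B hA hB hAB hU hμA hμB => ?_⟩
  refine lt_of_le_of_ne (integral_nonneg fun p => Γ.nonneg' _ _) fun h0 => ?_
  have hz := ae_eq_zero_of_setIntegral_eq_zero μ Γ hA hB h0.symm
  have hAY : ∀ a ∈ A, a ∈ Γ.ReachOut μ x ∧ x ∈ Γ.ReachOut μ a := fun a ha =>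
    hU.subset (Or.inl ha)
  have hBY : ∀ a ∈ B, a ∈ Γ.ReachOut μ x ∧ x ∈ Γ.ReachOut μ a := fun a ha =>
    hU.subset (Or.inr ha)
  -- If no arcs go from `A` to `B`, then `A` together with the points reachable from `x` that cannot
  -- return to `x` is essentially closed under arcs. So almost no point of `A` could reach `B`,
  -- although `A` reaches `x` and `x` reaches `B`.
  have hT : MeasurableSet ((Γ.ReachOut μ x ∩ {y | x ∈ Γ.ReachOut μ y}ᶜ) ∪ A) :=
    (hR.inter hQ.compl).union hA
  have hclosed : ∀ᵐ y ∂μ, y ∈ (Γ.ReachOut μ x ∩ {y | x ∈ Γ.ReachOut μ y}ᶜ) ∪ A →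
      ∀ᵐ z ∂μ, z ∉ (Γ.ReachOut μ x ∩ {y | x ∈ Γ.ReachOut μ y}ᶜ) ∪ A → Γ y z = 0 := by
    filter_upwards [ae_reachOut_subset μ Γ x, hz] with y hy1 hy2 hyT
    have hyR : y ∈ Γ.ReachOut μ x := hyT.elim (fun h => h.1) fun h => (hAY y h).1
    have hQz : ∀ᵐ z ∂μ, y ∉ A → z ∉ Γ.ReachOut μ y ∨ x ∉ Γ.ReachOut μ z := by
      by_cases hyA : y ∈ A
      · exact Filter.Eventually.of_forall fun z h => absurd hyA h
      · have : x ∉ Γ.ReachOut μ y := (hyT.resolve_right hyA).2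
        filter_upwards [ae_not_mem_reachOut_or μ Γ this] with z hz _ using hz
    filter_upwards [hy1 hyR, hy2, hQz] with z hz1 hz2 hz3 hzT
    by_cases hyz : z ∈ Γ.ReachOut μ y
    · have hzR := hz1 hyz
      have hzA : z ∉ A := fun h => hzT (Or.inr h)
      have hzQ : x ∈ Γ.ReachOut μ z := by
        by_contra h
        exact hzT (Or.inl ⟨hzR, h⟩)
      have hzB : z ∈ B := (hU.symm.subset ⟨hzR, hzQ⟩ : z ∈ A ∪ B).resolve_left hzA
      by_cases hyA : y ∈ A
      · exact hz2 hyA hzB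
      · exact absurd hzQ ((hz3 hyA).resolve_left (not_not.mpr hyz))
    · exact eq_zero_of_not_mem_reachOut μ Γ hyz
  have hA0 : ∀ᵐ a ∂μ, a ∉ A := by
    filter_upwards [ae_not_mem_reachOut_of_closed μ Γ hT hclosed, hx] with a ha1 ha2 haA
    refine hμB.ne' (measure_eq_zero_iff_ae_notMem.mpr ?_)
    filter_upwards [ha1 (Or.inr haA), ha2 (hAY a haA).2] with b hb1 hb2 hbB
    refine hb1 ?_ (hb2 (hBY b hbB).1)
    rintro (h | h)
    · exact h.2 (hBY b hbB).2
    · exact Set.disjoint_left.mp hAB h hbB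
  exact hμA.ne' (measure_eq_zero_iff_ae_notMem.mpr hA0)

omit [IsProbabilityMeasure μ] in
/-- A strongly connected set misses the fragmented part of a strong decomposition. -/
theorem IsStrongDecomposition.measure_inter_eq_zero {ι : Type*} [Countable ι] {Γ : Digraphon Ω}
    {X₀ : Set Ω} {C : ι → Set Ω} (hdec : Γ.IsStrongDecomposition μ X₀ C) {Y : Set Ω}
    (hY : Γ.StronglyConnected μ Y) : μ (Y ∩ X₀) = 0 := by
  by_contra hne
  have hpos : 0 < μ (Y ∩ X₀) := pos_iff_ne_zero.mpr hne
  rcases hdec.fragmented with h0 | ⟨hX₀, -, hfrag⟩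
  · rw [h0] at hne; simp at hne
  -- `Y` has positive measure outside `C i`, namely in `X₀`, so the maximality of the component
  -- forbids an overlap of positive measure. By countability `Y \ X₀` is null.
  have hC : ∀ i, ∀ᵐ y ∂μ, y ∉ C i ∩ Y := by
    intro i
    rw [← measure_eq_zero_iff_ae_notMem]
    by_contra hi
    refine (hdec.component i).2 Y hY.1 (pos_iff_ne_zero.mpr hi) (hpos.trans_le ?_) hY
    exact measure_mono fun y hy => ⟨hy.1, fun h => Set.disjoint_left.mp
      (hdec.disjoint_fragmented i) hy.2 h⟩
  rw [← ae_all_iff] at hC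
  have hYX : ∀ᵐ y ∂μ, y ∉ Y \ X₀ := by
    filter_upwards [hC] with y hy hyY
    have : y ∈ X₀ ∪ ⋃ i, C i := by rw [hdec.union_eq]; trivial
    obtain ⟨i, hi⟩ := Set.mem_iUnion.mp (this.resolve_left hyY.2)
    exact hy i ⟨hi, hyY.1⟩
  refine hfrag (Y ∩ X₀) (hY.1.inter hX₀) Set.inter_subset_right hpos
    ⟨hY.1.inter hX₀, hpos, fun A B hA hB hAB hU hμA hμB => ?_⟩
  have hAX : A ⊆ Y ∩ X₀ := hU ▸ Set.subset_union_left
  have hBX : B ⊆ Y ∩ X₀ := hU ▸ Set.subset_union_right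
  -- Adding the null set `Y \ X₀` to `A` turns a partition of `Y ∩ X₀` into one of `Y` without
  -- changing the integral.
  have h := hY.2.2 (A ∪ (Y \ X₀)) B (hA.union (hY.1.diff hX₀)) hB
    (hAB.union_left (Set.disjoint_left.mpr fun y hy hyB => hy.2 (hBX hyB).2))
    (by rw [Set.union_right_comm, hU, Set.inter_union_sdiff])
    (hμA.trans_le (measure_mono Set.subset_union_left)) hμB
  rwa [setIntegral_congr_set (t := A ×ˢ B)] at h
  refine Measure.set_prod_ae_eq ?_ (ae_eq_refl _)
  rw [Filter.eventuallyEq_set]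
  filter_upwards [hYX] with y hy
  exact ⟨fun h => h.resolve_right hy, Or.inl⟩

theorem IsStrongDecomposition.ae_not_mutual {ι : Type*} [Countable ι] {Γ : Digraphon Ω}
    {X₀ : Set Ω} {C : ι → Set Ω} (hdec : Γ.IsStrongDecomposition μ X₀ C) :
    ∀ᵐ x ∂μ, ∀ᵐ y ∂μ, y ∈ X₀ → ¬ (y ∈ Γ.ReachOut μ x ∧ x ∈ Γ.ReachOut μ y) := by
  filter_upwards [ae_stronglyConnected_mutual μ Γ] with x hx
  have h0 : μ ({y | y ∈ Γ.ReachOut μ x ∧ x ∈ Γ.ReachOut μ y} ∩ X₀) = 0 := by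
    by_cases h : 0 < μ {y | y ∈ Γ.ReachOut μ x ∧ x ∈ Γ.ReachOut μ y}
    · exact hdec.measure_inter_eq_zero μ (hx h)
    · exact measure_mono_null Set.inter_subset_left (nonpos_iff_eq_zero.mp (not_lt.mp h))
  filter_upwards [measure_eq_zero_iff_ae_notMem.mp h0] with y hy hy0 h
  exact hy ⟨h, hy0⟩

/-! ### Halving the reachable set, and the superlevel sets of `g` -/

/-- On `Z × Z` the reachability relation and its transpose have equal measure and are almost
disjoint, so each fills at most half of the square. Averaging over `Z` produces `y`. -/
theorem exists_reachOut_measure_le_half {Γ : Digraphon Ω} {F : Set Ω} (hF : MeasurableSet F)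
    (hmut : ∀ᵐ x ∂μ, ∀ᵐ y ∂μ, y ∈ F → ¬ (y ∈ Γ.ReachOut μ x ∧ x ∈ Γ.ReachOut μ y))
    (x : Ω) (hx : μ (Γ.ReachOut μ x ∩ F) ≠ 0) :
    ∃ y ∈ F, (∀ᵐ z ∂μ, z ∈ Γ.ReachOut μ y → z ∈ Γ.ReachOut μ x) ∧
      μ (Γ.ReachOut μ y ∩ F) ≤ μ (Γ.ReachOut μ x ∩ F) / 2 := by
  set Z := Γ.ReachOut μ x ∩ F with hZdef
  have hZ : MeasurableSet Z := (measurableSet_reachOut μ Γ x).inter hF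
  set ν := μ.restrict Z with hν
  have hS := measurableSet_reach μ Γ
  set S := {p : Ω × Ω | p.2 ∈ Γ.ReachOut μ p.1} with hSdef
  have hS' : MeasurableSet (Prod.swap ⁻¹' S) := measurable_swap hS
  have hdisj : AEDisjoint (ν.prod ν) S (Prod.swap ⁻¹' S) := by
    refine (Measure.measure_prod_null (hS.inter hS')).mpr ?_
    filter_upwards [ae_restrict_of_ae hmut] with y hy
    refine measure_eq_zero_iff_ae_notMem.mpr ((ae_restrict_iff' hZ).mpr ?_)
    filter_upwards [hy] with z hz hzZ hm
    exact hz hzZ.2 hm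
  have hsum : (ν.prod ν) S + (ν.prod ν) S ≤ μ Z * μ Z := by
    calc (ν.prod ν) S + (ν.prod ν) S
        = (ν.prod ν) S + (ν.prod ν) (Prod.swap ⁻¹' S) := by
          rw [(Measure.measurePreserving_swap (μ := ν) (ν := ν)).measure_preimage
            hS.nullMeasurableSet]
      _ = (ν.prod ν) (S ∪ Prod.swap ⁻¹' S) := (measure_union₀ hS'.nullMeasurableSet hdisj).symm
      _ ≤ (ν.prod ν) (Set.univ ×ˢ Set.univ) := measure_mono (by simp)
      _ = μ Z * μ Z := by rw [Measure.prod_prod, hν, Measure.restrict_apply_univ]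
  have hint : ∫⁻ y in Z, ν (Γ.ReachOut μ y) ∂μ = (ν.prod ν) S := (Measure.prod_apply hS).symm
  have hmeas : Measurable fun y => ν (Γ.ReachOut μ y) := measurable_measure_prodMk_left hS
  -- Points at or below the average have positive measure, so one of them avoids the null set where
  -- transitivity fails.
  have hpos := measure_le_setLAverage_pos hx (measure_ne_top μ Z) hmeas.aemeasurable
  have hfr : ∃ᵐ y ∂μ, y ∈ {y ∈ Z | ν (Γ.ReachOut μ y) ≤ ⨍⁻ a in Z, ν (Γ.ReachOut μ a) ∂μ} :=
    frequently_ae_mem_iff.mpr hpos.ne'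
  obtain ⟨y, ⟨hyZ, hy⟩, hyx⟩ := (hfr.and_eventually (ae_reachOut_subset μ Γ x)).exists
  refine ⟨y, hyZ.2, hyx hyZ.1, ?_⟩
  have h1 : μ (Γ.ReachOut μ y ∩ F) ≤ ν (Γ.ReachOut μ y) := by
    rw [hν, Measure.restrict_apply (measurableSet_reachOut μ Γ y)]
    refine measure_mono_ae ?_
    filter_upwards [hyx hyZ.1] with z hz hzF
    exact ⟨hzF.1, hz hzF.1, hzF.2⟩
  refine h1.trans (hy.trans ?_)
  rw [setLAverage_eq, hint]
  refine ENNReal.div_le_of_le_mul ?_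
  rw [← two_mul] at hsum
  rw [← ENNReal.mul_div_right_comm, ENNReal.le_div_iff_mul_le (by simp) (by simp), mul_comm]
  exact hsum

theorem exists_reachOut_measure_le_pow {Γ : Digraphon Ω} {F : Set Ω} (hF : MeasurableSet F)
    (hmut : ∀ᵐ x ∂μ, ∀ᵐ y ∂μ, y ∈ F → ¬ (y ∈ Γ.ReachOut μ x ∧ x ∈ Γ.ReachOut μ y))
    (x : Ω) (hx : x ∈ F) (k : ℕ) :
    ∃ y ∈ F, (∀ᵐ z ∂μ, z ∈ Γ.ReachOut μ y → z ∈ Γ.ReachOut μ x) ∧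
      μ (Γ.ReachOut μ y ∩ F) ≤ 2⁻¹ ^ k := by
  induction k with
  | zero => exact ⟨x, hx, Filter.Eventually.of_forall fun z h => h, by simpa using prob_le_one⟩
  | succ k ih =>
    obtain ⟨y, hyF, hyx, hy⟩ := ih
    by_cases h0 : μ (Γ.ReachOut μ y ∩ F) = 0
    · exact ⟨y, hyF, hyx, by rw [h0]; exact zero_le⟩
    · obtain ⟨z, hzF, hzy, hz⟩ := exists_reachOut_measure_le_half μ hF hmut y h0
      refine ⟨z, hzF, ?_, hz.trans ?_⟩
      · filter_upwards [hzy, hyx] with w h1 h2 h3 using h2 (h1 h3)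
      · rw [pow_succ, div_eq_mul_inv]
        gcongr

theorem measurable_reachMeasure (Γ : Digraphon Ω) {X : Set Ω} (hX : MeasurableSet X) :
    Measurable (Γ.reachMeasure μ X) := by
  have hs : MeasurableSet ({p : Ω × Ω | p.2 ∈ Γ.ReachOut μ p.1} ∩ Prod.snd ⁻¹' X) :=
    (measurableSet_reach μ Γ).inter (measurable_snd hX)
  exact (measurable_measure_prodMk_left (ν := μ) hs).ennreal_toReal

theorem measurableSet_superlevel (Γ : Digraphon Ω) {X : Set Ω} (hX : MeasurableSet X) (a : ℝ) :
    MeasurableSet (Γ.superlevel μ X a) :=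
  hX.inter (measurable_reachMeasure μ Γ hX measurableSet_Icc)

theorem mem_superlevel_iff (Γ : Digraphon Ω) {X : Set Ω} {a : ℝ} {x : Ω} :
    x ∈ Γ.superlevel μ X a ↔ x ∈ X ∧ a ≤ Γ.reachMeasure μ X x :=
  and_congr_right fun _ => and_iff_left measureReal_le_one

/-- Repeated halving stays inside the superlevel set, so the final `y` still reaches measure `a` in
`X`, of which at most `2⁻¹ ^ k < ε` lies in that set. -/
theorem le_measure_reachOut_diff_superlevel {Γ : Digraphon Ω} {X : Set Ω} (hX : MeasurableSet X)
    (hmut : ∀ᵐ x ∂μ, ∀ᵐ y ∂μ, y ∈ X → ¬ (y ∈ Γ.ReachOut μ x ∧ x ∈ Γ.ReachOut μ y))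
    (a : ℝ) {x : Ω} (hx : x ∈ Γ.superlevel μ X a) :
    a ≤ μ.real ((Γ.ReachOut μ x ∩ X) \ Γ.superlevel μ X a) := by
  have hF := measurableSet_superlevel μ Γ hX a
  have hmut' : ∀ᵐ x ∂μ, ∀ᵐ y ∂μ, y ∈ Γ.superlevel μ X a →
      ¬ (y ∈ Γ.ReachOut μ x ∧ x ∈ Γ.ReachOut μ y) := by
    filter_upwards [hmut] with x h
    filter_upwards [h] with y hy hyF using hy hyF.1
  refine le_of_forall_pos_le_add fun ε hε => ?_
  obtain ⟨k, hk⟩ := exists_pow_lt_of_lt_one hε (by norm_num : (2⁻¹ : ℝ) < 1)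
  obtain ⟨y, hyF, hyx, hy⟩ := exists_reachOut_measure_le_pow μ hF hmut' x hx k
  have hy' : μ.real (Γ.ReachOut μ y ∩ Γ.superlevel μ X a) ≤ 2⁻¹ ^ k := by
    have := ENNReal.toReal_mono (by simp) hy
    simpa [measureReal_def] using this
  have h1 : a ≤ μ.real (Γ.ReachOut μ y ∩ X) := ((mem_superlevel_iff μ Γ).mp hyF).2
  have h2 : μ.real (Γ.ReachOut μ y ∩ X) ≤
      μ.real ((Γ.ReachOut μ x ∩ X) \ Γ.superlevel μ X a) +
        μ.real (Γ.ReachOut μ y ∩ Γ.superlevel μ X a) := by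
    refine le_trans ?_ (measureReal_union_le _ _)
    refine ENNReal.toReal_mono (measure_ne_top _ _) (measure_mono_ae ?_)
    filter_upwards [hyx] with z hz hzX
    by_cases hzF : z ∈ Γ.superlevel μ X a
    · exact Or.inr ⟨hzX.1, hzF⟩
    · exact Or.inl ⟨⟨hz hzX.1, hzX.2⟩, hzF⟩
  linarith

theorem measure_superlevel_le {Γ : Digraphon Ω} {X : Set Ω} (hX : MeasurableSet X)
    (hmut : ∀ᵐ x ∂μ, ∀ᵐ y ∂μ, y ∈ X → ¬ (y ∈ Γ.ReachOut μ x ∧ x ∈ Γ.ReachOut μ y))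
    {a : ℝ} (ha : a ≤ μ.real X) : μ.real (Γ.superlevel μ X a) ≤ μ.real X - a := by
  rcases (Γ.superlevel μ X a).eq_empty_or_nonempty with h | ⟨x, hx⟩
  · rw [h]; simpa using ha
  · have h1 := le_measure_reachOut_diff_superlevel μ hX hmut a hx
    have h2 : μ.real ((Γ.ReachOut μ x ∩ X) \ Γ.superlevel μ X a) ≤
        μ.real (X \ Γ.superlevel μ X a) :=
      measureReal_mono (Set.sdiff_subset_sdiff_left Set.inter_subset_right)
    rw [measureReal_sdiff (fun y hy => hy.1) (measurableSet_superlevel μ Γ hX a)] at h2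
    linarith

/-- Almost all points of `X` reachable from `x` reach strictly less of `X` than `x` does. -/
theorem ae_reachMeasure_lt {Γ : Digraphon Ω} {X : Set Ω} (hX : MeasurableSet X)
    (hmut : ∀ᵐ x ∂μ, ∀ᵐ y ∂μ, y ∈ X → ¬ (y ∈ Γ.ReachOut μ x ∧ x ∈ Γ.ReachOut μ y))
    {x : Ω} (hx : x ∈ X) :
    ∀ᵐ y ∂μ, y ∈ X → y ∈ Γ.ReachOut μ x → Γ.reachMeasure μ X y < Γ.reachMeasure μ X x := by
  -- With threshold `g x` the bound says that all of the measure that `x` reaches in `X` lies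
  -- outside `F`.
  set F := Γ.superlevel μ X (Γ.reachMeasure μ X x) with hFdef
  have hF : MeasurableSet F := measurableSet_superlevel μ Γ hX _
  have h1 : μ.real (Γ.ReachOut μ x ∩ X) ≤ μ.real ((Γ.ReachOut μ x ∩ X) \ F) :=
    le_measure_reachOut_diff_superlevel μ hX hmut _ ((mem_superlevel_iff μ Γ).mpr ⟨hx, le_rfl⟩)
  have h2 := measureReal_inter_add_sdiff (μ := μ) (s := Γ.ReachOut μ x ∩ X) hF
  have h3 : μ.real (Γ.ReachOut μ x ∩ X ∩ F) = 0 :=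
    le_antisymm (by linarith) measureReal_nonneg
  rw [measureReal_eq_zero_iff] at h3
  filter_upwards [measure_eq_zero_iff_ae_notMem.mp h3] with y hy hyX hyR
  by_contra! hlt
  exact hy ⟨⟨hyR, hyX⟩, (mem_superlevel_iff μ Γ).mpr ⟨hyX, hlt⟩⟩

theorem ae_eq_zero_of_reachMeasure_le {Γ : Digraphon Ω} {X : Set Ω} (hX : MeasurableSet X)
    (hmut : ∀ᵐ x ∂μ, ∀ᵐ y ∂μ, y ∈ X → ¬ (y ∈ Γ.ReachOut μ x ∧ x ∈ Γ.ReachOut μ y)) :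
    ∀ᵐ p ∂(μ.prod μ), p.1 ∈ X → p.2 ∈ X →
      Γ.reachMeasure μ X p.1 ≤ Γ.reachMeasure μ X p.2 → Γ p.1 p.2 = 0 := by
  have hg := measurable_reachMeasure μ Γ hX
  refine (Measure.ae_prod_iff_ae_ae ?_).mpr (Filter.Eventually.of_forall fun x => ?_)
  · have h : MeasurableSet ((Prod.fst ⁻¹' X)ᶜ ∪ ((Prod.snd ⁻¹' X)ᶜ ∪
        ({p : Ω × Ω | Γ.reachMeasure μ X p.1 ≤ Γ.reachMeasure μ X p.2}ᶜ ∪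
          {p : Ω × Ω | Γ p.1 p.2 = 0}))) :=
      (measurable_fst hX).compl.union ((measurable_snd hX).compl.union
        ((measurableSet_le (hg.comp measurable_fst) (hg.comp measurable_snd)).compl.union
          Γ.measurableSet_eq_zero))
    convert h using 1
    ext p
    simp only [Set.mem_ofPred_eq, Set.mem_union, Set.mem_compl_iff, Set.mem_preimage,
      imp_iff_not_or]
  · by_cases hx : x ∈ X
    · filter_upwards [ae_reachMeasure_lt μ hX hmut hx] with y hy _ hyX hle
      by_contra hne
      exact (hy hyX (by_contra fun h => hne (eq_zero_of_not_mem_reachOut μ Γ h))).not_ge hle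
    · exact Filter.Eventually.of_forall fun y h => absurd h hx

end Digraphon

/-! ### Factorial decay of the mass of monotone chains -/

/-- `chainMass μ g n x` is the measure of the set of the chains `g x < g y₁ < ⋯ < g yₙ`, as an
iterated integral. -/
def chainMass {Ω : Type*} [MeasurableSpace Ω] (μ : Measure Ω) (g : Ω → ℝ) : ℕ → Ω → ENNReal
  | 0, _ => 1
  | n + 1, x => ∫⁻ y, (if g x < g y then 1 else 0) * chainMass μ g n y ∂μ

section ChainMass

variable {Ω : Type*} [MeasurableSpace Ω] (μ : Measure Ω) [IsProbabilityMeasure μ] {g : Ω → ℝ}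

theorem measurable_ite_lt (hg : Measurable g) :
    Measurable fun p : Ω × Ω => if g p.1 < g p.2 then (1 : ENNReal) else 0 :=
  Measurable.ite (measurableSet_lt (hg.comp measurable_fst) (hg.comp measurable_snd))
    measurable_const measurable_const

theorem measurable_chainMass (hg : Measurable g) (n : ℕ) : Measurable (chainMass μ g n) := by
  induction n with
  | zero => exact measurable_const
  | succ n ih =>
    exact ((measurable_ite_lt hg).mul (ih.comp measurable_snd)).lintegral_prod_right'

theorem chainMass_one_le (x : Ω) : chainMass μ g 1 x ≤ 1 := by
  calc chainMass μ g 1 x ≤ ∫⁻ _, 1 ∂μ := by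
        refine lintegral_mono fun y => ?_
        simp only [chainMass]
        split_ifs <;> simp
    _ = 1 := by simp

/-- A free point above `x` can be inserted into a chain of length `n` in `n + 1` mutually exclusive
positions. The induction compares it with the first chain point `y`: above `y` the hypothesis
applies, below `y` it extends the chain. -/
theorem succ_mul_chainMass_succ_le (hg : Measurable g) (n : ℕ) (x : Ω) :
    ((n + 1 : ℕ) : ENNReal) * chainMass μ g (n + 1) x ≤ chainMass μ g n x * chainMass μ g 1 x := by
  induction n generalizing x with
  | zero => simp [chainMass]
  | succ n ih =>
    set K : Ω → Ω → ENNReal := fun x y => if g x < g y then 1 else 0 with hK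
    have hKm : Measurable fun p : Ω × Ω => K p.1 p.2 := measurable_ite_lt hg
    have hKx : ∀ x, Measurable (K x) := fun x => hKm.comp measurable_prodMk_left
    have he := measurable_chainMass μ hg
    have hKe : ∀ x n, Measurable fun y => K x y * chainMass μ g n y :=
      fun x n => (hKx x).mul (he n)
    -- At most one of the two orders of `y` and `z` occurs, and either one puts both above `x`.
    have hpt : ∀ y z, K x y * K y z + K x z * K z y ≤ K x y * K x z := by
      intro y z
      simp only [hK]
      by_cases h1 : g x < g y <;> by_cases h2 : g y < g z <;> by_cases h3 : g x < g z <;>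
        by_cases h4 : g z < g y <;> simp [h1, h2, h3, h4] <;> linarith
    have e0 : ∀ n x, chainMass μ g (n + 1) x = ∫⁻ y, K x y * chainMass μ g n y ∂μ :=
      fun _ _ => rfl
    have e1 : ∀ x, chainMass μ g 1 x = ∫⁻ z, K x z ∂μ := fun x => by
      rw [e0]; simp [chainMass]
    have hswap : ∫⁻ y, ∫⁻ z, chainMass μ g n y * (K x z * K z y) ∂μ ∂μ =
        chainMass μ g (n + 2) x := by
      rw [lintegral_lintegral_swap]
      · rw [e0]
        refine lintegral_congr fun z => ?_
        rw [e0, ← lintegral_const_mul _ (hKe z n)]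
        exact lintegral_congr fun y => by ring
      · exact (((he n).comp measurable_fst).mul (((hKx x).comp measurable_snd).mul
          (hKm.comp measurable_swap))).aemeasurable
    calc ((n + 1 + 1 : ℕ) : ENNReal) * chainMass μ g (n + 1 + 1) x
        = ((n + 1 : ℕ) : ENNReal) * chainMass μ g (n + 2) x + chainMass μ g (n + 2) x := by
          push_cast; ring
      _ = ∫⁻ y, K x y * (((n + 1 : ℕ) : ENNReal) * chainMass μ g (n + 1) y) ∂μ
            + chainMass μ g (n + 2) x := by
          congr 1
          rw [e0, ← lintegral_const_mul _ (hKe x (n + 1))]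
          exact lintegral_congr fun y => by ring
      _ ≤ ∫⁻ y, K x y * (chainMass μ g n y * chainMass μ g 1 y) ∂μ
            + chainMass μ g (n + 2) x := by
          exact add_le_add_left (lintegral_mono fun y => mul_le_mul' le_rfl (ih y)) _
      _ = ∫⁻ y, ∫⁻ z, chainMass μ g n y * (K x y * K y z) ∂μ ∂μ
            + ∫⁻ y, ∫⁻ z, chainMass μ g n y * (K x z * K z y) ∂μ ∂μ := by
          rw [hswap]
          congr 1
          refine lintegral_congr fun y => ?_
          rw [e1, ← lintegral_const_mul _ (hKx y), ← lintegral_const_mul _ ((hKx y).const_mul _)]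
          exact lintegral_congr fun z => by ring
      _ = ∫⁻ y, ∫⁻ z, chainMass μ g n y * (K x y * K y z + K x z * K z y) ∂μ ∂μ := by
          rw [← lintegral_add_left]
          · refine lintegral_congr fun y => ?_
            rw [← lintegral_add_left (((hKx y).const_mul _).const_mul _)]
            exact lintegral_congr fun z => by ring
          · exact (((he n).comp measurable_fst).mul
              (((hKx x).comp measurable_fst).mul hKm)).lintegral_prod_right'
      _ ≤ ∫⁻ y, ∫⁻ z, chainMass μ g n y * (K x y * K x z) ∂μ ∂μ := by
          gcongr with y z
          exact hpt y z
      _ = chainMass μ g (n + 1) x * chainMass μ g 1 x := by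
          rw [e0, e1, ← lintegral_mul_const _ (hKe x n)]
          refine lintegral_congr fun y => ?_
          rw [← lintegral_const_mul _ (hKx x)]
          exact lintegral_congr fun z => by ring

theorem factorial_mul_chainMass_le (hg : Measurable g) (n : ℕ) (x : Ω) :
    (n.factorial : ENNReal) * chainMass μ g n x ≤ 1 := by
  induction n with
  | zero => simp [chainMass]
  | succ n ih =>
    calc ((n + 1).factorial : ENNReal) * chainMass μ g (n + 1) x
        = n.factorial * (((n + 1 : ℕ) : ENNReal) * chainMass μ g (n + 1) x) := by
          rw [Nat.factorial_succ]; push_cast; ring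
      _ ≤ n.factorial * (chainMass μ g n x * chainMass μ g 1 x) := by
          exact mul_le_mul' le_rfl (succ_mul_chainMass_succ_le μ hg n x)
      _ = (n.factorial * chainMass μ g n x) * chainMass μ g 1 x := by ring
      _ ≤ 1 := mul_le_one' ih (chainMass_one_le μ x)

end ChainMass

/-! ### From factorial decay to spectral radius zero -/

/-- An operator whose powers decay like `1 / n!` is quasinilpotent. -/
theorem spectralRadius_eq_zero_of_norm_pow_le {A : Type*} [NormedRing A] [NormedAlgebra ℂ A]
    [CompleteSpace A] {a : A} (h : ∀ n : ℕ, ‖a ^ (n + 1)‖ ≤ (n.factorial : ℝ)⁻¹) :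
    spectralRadius ℂ a = 0 := by
  simp only [spectralRadius, ENNReal.iSup_eq_zero]
  intro k hk
  by_contra hne
  have hk0 : 0 < ‖k‖ := norm_pos_iff.mpr fun h0 => hne (by simp [h0])
  -- As `k ^ (n + 1)` lies in the spectrum of `a ^ (n + 1)`, its norm is bounded; dividing by `‖k‖ ^
  -- n` leaves a bound that tends to zero.
  have hle : ∀ n : ℕ, ‖k‖ ≤ ‖(1 : A)‖ * (‖k‖⁻¹ ^ n / n.factorial) := by
    intro n
    have h1 := spectrum.norm_le_norm_mul_of_mem (spectrum.pow_mem_pow a (n + 1) hk)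
    rw [norm_pow] at h1
    have h2 : ‖k‖ ^ (n + 1) ≤ (n.factorial : ℝ)⁻¹ * ‖(1 : A)‖ :=
      h1.trans (mul_le_mul_of_nonneg_right (h n) (norm_nonneg _))
    calc ‖k‖ = ‖k‖ ^ (n + 1) * ‖k‖⁻¹ ^ n := by
          rw [pow_succ', mul_assoc, ← mul_pow, mul_inv_cancel₀ hk0.ne', one_pow, mul_one]
      _ ≤ ((n.factorial : ℝ)⁻¹ * ‖(1 : A)‖) * ‖k‖⁻¹ ^ n := by gcongr
      _ = ‖(1 : A)‖ * (‖k‖⁻¹ ^ n / n.factorial) := by ring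
  have hlim := (FloorSemiring.tendsto_pow_div_factorial_atTop ‖k‖⁻¹).const_mul ‖(1 : A)‖
  rw [mul_zero] at hlim
  exact hk0.not_ge (ge_of_tendsto' hlim hle)

namespace Digraphon

variable {Ω : Type*} [MeasurableSpace Ω] (μ : Measure Ω) [IsProbabilityMeasure μ]

theorem operator_apply_ae (Γ : Digraphon Ω) (f : Lp ℂ 2 μ) :
    ∀ᵐ x ∂μ, Γ.operator μ f x = ∫ y, f y * (Γ y x : ℂ) ∂μ :=
  (memLp_integral_kernel μ Γ f).coeFn_toLp

/-- The first application costs only the passage from `L²` to a pointwise bound; each further one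
restricts to `g x < g y` and adds one link to the chain. Hence the power `n + 1` against length `n`.
-/
theorem enorm_operator_pow_apply_le {Γ : Digraphon Ω} {g : Ω → ℝ} (hg : Measurable g)
    (h : ∀ᵐ x ∂μ, ∀ᵐ y ∂μ, g y ≤ g x → Γ y x = 0) (n : ℕ) (f : Lp ℂ 2 μ) :
    ∀ᵐ x ∂μ, ‖(Γ.operator μ ^ (n + 1)) f x‖ₑ ≤ ‖f‖ₑ * chainMass μ g n x := by
  induction n with
  | zero =>
    filter_upwards [operator_apply_ae μ Γ f] with x hx
    rw [zero_add, pow_one, hx, chainMass, mul_one]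
    exact enorm_le_iff_norm_le.mpr (norm_integral_kernel_le μ Γ f x)
  | succ n ih =>
    rw [pow_succ', mul_apply_eq_comp]
    filter_upwards [operator_apply_ae μ Γ ((Γ.operator μ ^ (n + 1)) f), h] with x hx hxy
    rw [hx]
    refine (enorm_integral_le_lintegral_enorm _).trans ?_
    have hm : Measurable fun y => (if g x < g y then (1 : ENNReal) else 0) * chainMass μ g n y :=
      ((measurable_ite_lt hg).comp measurable_prodMk_left).mul (measurable_chainMass μ hg n)
    rw [chainMass, ← lintegral_const_mul _ hm]
    refine lintegral_mono_ae ?_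
    filter_upwards [ih, hxy] with y hy hgy
    by_cases hlt : g x < g y
    · rw [if_pos hlt, one_mul]
      exact (enorm_le_iff_norm_le.mpr (norm_kernel_le μ Γ _ x y)).trans hy
    · rw [hgy (not_lt.mp hlt)]; simp

theorem rho_eq_zero_of_strict_mono {Γ : Digraphon Ω} {g : Ω → ℝ} (hg : Measurable g)
    (h : ∀ᵐ x ∂μ, ∀ᵐ y ∂μ, g y ≤ g x → Γ y x = 0) : rho μ Γ = 0 := by
  refine spectralRadius_eq_zero_of_norm_pow_le fun n => ?_
  refine ContinuousLinearMap.opNorm_le_bound _ (by positivity) fun f => ?_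
  have hb : ∀ᵐ x ∂μ, ‖(Γ.operator μ ^ (n + 1)) f x‖ ≤ (n.factorial : ℝ)⁻¹ * ‖f‖ := by
    filter_upwards [enorm_operator_pow_apply_le μ hg h n f] with x hx
    have h1 : (n.factorial : ENNReal) * ‖(Γ.operator μ ^ (n + 1)) f x‖ₑ ≤ ‖f‖ₑ :=
      calc _ ≤ (n.factorial : ENNReal) * (‖f‖ₑ * chainMass μ g n x) := by gcongr
        _ = ‖f‖ₑ * (n.factorial * chainMass μ g n x) := by ring
        _ ≤ ‖f‖ₑ * 1 := by gcongr; exact factorial_mul_chainMass_le μ hg n x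
        _ = ‖f‖ₑ := mul_one _
    have h2 := ENNReal.toReal_mono enorm_ne_top h1
    rw [ENNReal.toReal_mul, toReal_enorm, toReal_enorm, ENNReal.toReal_natCast] at h2
    rw [inv_mul_eq_div, le_div_iff₀ (by positivity), mul_comm]
    exact h2
  have hn := Lp.norm_le_of_ae_bound (by positivity) hb
  have h1 : (measureUnivNNReal μ : ℝ) = 1 := by simp [measureUnivNNReal]
  rwa [h1, Real.one_rpow, one_mul] at hn

theorem rho_restrict_eq_zero {Γ : Digraphon Ω} {X : Set Ω} (hX : MeasurableSet X) {g : Ω → ℝ}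
    (hg : Measurable g)
    (h : ∀ᵐ p ∂(μ.prod μ), p.1 ∈ X → p.2 ∈ X → g p.1 ≤ g p.2 → Γ p.1 p.2 = 0) :
    rho μ (Γ.restrict X hX) = 0 := by
  refine rho_eq_zero_of_strict_mono μ hg ?_
  -- The operator integrates over the first argument of the kernel, so the coordinates are
  -- exchanged.
  have h' := (Measure.measurePreserving_swap (μ := μ) (ν := μ)).quasiMeasurePreserving.ae h
  filter_upwards [Measure.ae_ae_of_ae_prod h'] with x hx
  filter_upwards [hx] with y hy hle
  simp only [restrict]
  split_ifs with hm
  · exact hy hm.1 hm.2 hle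
  · rfl

end Digraphon
end

theorem proposition4p8 {Ω : Type*} [MeasurableSpace Ω] (μ : Measure Ω) [IsProbabilityMeasure μ]
    (Γ : Digraphon Ω) {ι : Type*} [Countable ι] (X₀ : Set Ω) (C : ι → Set Ω)
    (hdec : Γ.IsStrongDecomposition μ X₀ C)
    (X : Set Ω) (hX : MeasurableSet X) (hXX₀ : X ⊆ X₀) (hXpos : 0 < μ X) :
    (∀ a : ℝ, 0 ≤ a → ∀ᵐ x ∂μ, x ∈ Γ.superlevel μ X a →
      a ≤ μ.real ((Γ.ReachOut μ x ∩ X) \ Γ.superlevel μ X a)) ∧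
    (∀ a : ℝ, 0 ≤ a → a ≤ μ.real X → μ.real (Γ.superlevel μ X a) ≤ μ.real X - a) ∧
    (∀ᵐ p ∂(μ.prod μ), p.1 ∈ X → p.2 ∈ X →
      Γ.reachMeasure μ X p.1 ≤ Γ.reachMeasure μ X p.2 → Γ p.1 p.2 = 0) ∧
    Digraphon.rho μ (Γ.restrict X hX) = 0 := by
  have hmut : ∀ᵐ x ∂μ, ∀ᵐ y ∂μ, y ∈ X → ¬ (y ∈ Γ.ReachOut μ x ∧ x ∈ Γ.ReachOut μ y) := by
    filter_upwards [hdec.ae_not_mutual μ] with x hx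
    filter_upwards [hx] with y hy hyX using hy (hXX₀ hyX)
  have h3 := Digraphon.ae_eq_zero_of_reachMeasure_le μ hX hmut
  exact ⟨fun a _ => Filter.Eventually.of_forall fun x hx =>
      Digraphon.le_measure_reachOut_diff_superlevel μ hX hmut a hx,
    fun a _ ha => Digraphon.measure_superlevel_le μ hX hmut ha, h3,
    Digraphon.rho_restrict_eq_zero μ hX (Digraphon.measurable_reachMeasure μ Γ hX) h3⟩
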